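/- For a finite simple graph $G$, let $N(G)$ denote the number of connected induced subgraphs of $G$, that is, the number of nonempty vertex subsets $S\subseteq V(G)$ for which the subgraph of $G$ induced by $S$ is connected. A pendant vertex is a vertex of degree $1$. For $n\ge 6$, let $D_n$ be the graph of order $n$ obtained from two triangles and a path $P_{n-4}$ on $n-4$ vertices (all three vertex-disjoint) by identifying one end vertex of the path with a vertex of one triangle and the other end vertex with a vertex of the other triangle. Let $n>5$ be an integer. The graph $D_n$ is a connected graph of order $n$ with no pendant vertex, and $$N(D_n)=\frac{(n-1)(n+6)}{2}.$$ Every connected graph $G$ of order $n$ with no pendant vertex satisfies $$N(G)\ge N(D_n)=\frac{(n-1)(n+6)}{2},$$ and equality holds if and only if $G$ is isomorphic to $D_n$. -/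

import Mathlib

/-- The number `N(G)` of connected induced subgraphs of `G`. An induced subgraph is determined by
its vertex set; `Connected` includes that this set is nonempty. -/
noncomputable def numConnectedInduced {V : Type*} (G : SimpleGraph V) : ℕ :=
  {s : Set V | (G.induce s).Connected}.ncard

open Classical in
/-- A pendant vertex (leaf): a vertex of degree `1`. -/
def IsPendant {V : Type*} [Fintype V] (G : SimpleGraph V) (v : V) : Prop :=
  G.degree v = 1

/-- Membership of `G` in the class `𝒢(n, p)` of connected graphs with `n` vertices, exactly `p` of
which are pendant. -/
structure IsConnectedWithPendants {V : Type*} [Fintype V] (G : SimpleGraph V) (n p : ℕ) :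
    Prop where
  connected : G.Connected
  order : Fintype.card V = n
  pendants : {v : V | IsPendant G v}.ncard = p

/-- The double tadpole graph `D_n(l; r)`, for `3 ≤ l`, `3 ≤ r`, `l + r ≤ n`, on the vertices
`0, …, n - 1`. Besides the edges `{i, i + 1}` there are the edges `{0, l - 1}`, which closes the
cycle `C_l` on `0, …, l - 1`, and `{n - r, n - 1}`, which closes the cycle `C_r` on
`n - r, …, n - 1`. The two cycles are joined by the path on `l - 1, …, n - r`, which has
`n + 2 - l - r` vertices and whose leaves are identified with a vertex of each cycle. -/
def doubleTadpole (n l r : ℕ) : SimpleGraph (Fin n) :=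
  SimpleGraph.fromRel fun i j =>
    (i : ℕ) + 1 = j ∨ ((i : ℕ) = 0 ∧ (j : ℕ) + 1 = l) ∨ ((i : ℕ) + r = n ∧ (j : ℕ) + 1 = n)

/-!
Call a vertex set *connected* if it induces a connected subgraph. The number of connected sets of
`G` is bounded below according to whether `G` has a cut vertex.

The tool in both cases is a count of the connected sets between two given ones. A connected set can
be enlarged inside a bigger connected set one vertex at a time, so there are at least `|B \ A| + 1`
connected sets between connected `A ⊆ B`; deleting non-cut vertices one by one, a connected set `B`
contains at least `(|B| + 1).choose 2` connected sets. If no single vertex of the connected set `W`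
disconnects `A ∪ W`, then some neighbour `u ∈ W` of `A` leaves `W \ {u}` connected
(`exists_adj_connected_diff_singleton`), and moving `u` from `W` to `A` shows inductively that at
least `(|W| + 1).choose 2 + 1` connected sets lie between `A` and `A ∪ W`
(`succ_choose_le_ncard_connectedBetween_union`).

If `G` has no cut vertex, fix a vertex `v` and count the connected sets avoiding and containing `v`:
there are at least `n * (n - 1) + 1` in all, which exceeds `(n - 1) * (n + 6) / 2` for `n > 5`.

If `G` has a cut vertex, minimal pieces cut off by one vertex are connected and contain no cut
vertex, so there are two disjoint ones, `K₁` and `K₂`, attached at `c₁` and `c₂` to the connected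
rest `M` (`exists_twoEnds`). Connected sets meeting both `Kᵢ` and `M` are glued at `cᵢ`. With
`α = (|K₁| + 1).choose 2`, `β = (|K₂| + 1).choose 2`, `r = |M|` and `t` the number of connected sets
between `{c₁, c₂}` and `M`, sorting the connected sets by which of `K₁`, `K₂`, `M` they meet gives
`(r + 1).choose 2 + (r + 1) * (α + β) + t * α * β` as a lower bound (`TwoEnds.le_ncard`). Without
pendant vertices `|Kᵢ| ≥ 2`, and the bound is then at least `(n - 1) * (n + 6) / 2`, with equality
only for `|K₁| = |K₂| = 2` and `t = 1`. In that case each `Kᵢ ∪ {cᵢ}` is a triangle and `M` is the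
vertex set of a shortest path from `c₁` to `c₂`, so `G` is `D_n` (`TwoEnds.nonempty_iso`).

For `D_n` itself the matching upper bound comes from listing its connected sets: intervals of
`{0, …, n - 1}`, from which `1` or `n - 2` may be missing.
-/

open Set

namespace SimpleGraph

/-! ### Connected sets and how many lie between two given ones -/

section ConnectedSets

variable {V : Type*} {G : SimpleGraph V} {A B S T W : Set V}

/-- A set is connected iff it is nonempty and every partition of it into two nonempty parts is
crossed by an edge. -/
theorem connected_induce_iff_exists_adj :
    (G.induce S).Connected ↔ S.Nonempty ∧
      ∀ T ⊆ S, T.Nonempty → (S \ T).Nonempty → ∃ x ∈ T, ∃ y ∈ S \ T, G.Adj x y := by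
  constructor
  · intro h
    refine ⟨Set.nonempty_coe_sort.mp h.nonempty, ?_⟩
    rintro T hTS ⟨t, ht⟩ ⟨s, hs⟩
    obtain ⟨w⟩ := h.preconnected ⟨t, hTS ht⟩ ⟨s, hs.1⟩
    obtain ⟨d, -, hd1, hd2⟩ := w.exists_boundary_dart {x | (x : V) ∈ T} ht hs.2
    exact ⟨d.fst, hd1, d.snd, ⟨d.snd.2, hd2⟩, d.adj⟩
  · rintro ⟨⟨x₀, hx₀⟩, h⟩
    refine (connected_iff_exists_forall_reachable _).2 ⟨⟨x₀, hx₀⟩, ?_⟩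
    by_contra! hcon
    obtain ⟨z, hz⟩ := hcon
    obtain ⟨x, ⟨hxS, hx⟩, y, ⟨hyS, hy⟩, hxy⟩ :=
      h {x | ∃ hx : x ∈ S, (G.induce S).Reachable ⟨x₀, hx₀⟩ ⟨x, hx⟩}
        (fun x hx => hx.1) ⟨x₀, hx₀, Reachable.refl _⟩ ⟨z, z.2, fun hz' => hz hz'.2⟩
    exact hy ⟨hyS, hx.trans (Adj.reachable (by simpa using hxy))⟩

theorem connected_induce_singleton (x : V) : (G.induce {x}).Connected :=
  connected_induce_iff_exists_adj.2 ⟨singleton_nonempty x, by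
    rintro T hT ⟨t, ht⟩ ⟨s, hs⟩
    have h1 := hT ht
    have h2 := hs.1
    rw [mem_singleton_iff] at h1 h2
    subst h1 h2
    exact absurd ht hs.2⟩

theorem connected_induce_insert (hS : (G.induce S).Connected) {x y : V} (hx : x ∈ S)
    (hxy : G.Adj x y) : (G.induce (insert y S)).Connected := by
  rw [insert_eq, union_comm]
  exact connected_induce_union hS.preconnected (connected_induce_singleton y).preconnected hx rfl
    hxy

theorem exists_connected_induce_insert (hA : (G.induce A).Connected)
    (hB : (G.induce B).Connected) (hAB : A ⊂ B) :
    ∃ x ∈ B \ A, (G.induce (insert x A)).Connected := by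
  obtain ⟨a, ha, b, hb, hab⟩ := (connected_induce_iff_exists_adj.1 hB).2 A hAB.1
    (connected_induce_iff_exists_adj.1 hA).1 (nonempty_of_ssubset hAB)
  exact ⟨b, hb, connected_induce_insert hA ha hab⟩

variable [Finite V]

/-- A connected set `B` has a vertex outside a given connected proper subset `A` whose deletion
keeps `B` connected: grow `A` to `B`; the last vertex added can be removed. -/
theorem exists_connected_induce_diff_singleton (hA : (G.induce A).Connected)
    (hB : (G.induce B).Connected) (hAB : A ⊂ B) :
    ∃ x ∈ B \ A, (G.induce (B \ {x})).Connected := by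
  induction hk : (B \ A).ncard using Nat.strong_induction_on generalizing A with
  | _ k ih =>
    obtain ⟨x, hx, hxA⟩ := exists_connected_induce_insert hA hB hAB
    rcases (insert_subset hx.1 hAB.1).eq_or_ssubset with h | h
    · refine ⟨x, hx, ?_⟩
      rwa [← h, insert_sdiff_self_of_notMem hx.2]
    · obtain ⟨y, hy, hyB⟩ := ih _ (by
        rw [← hk]
        apply ncard_lt_ncard _ (toFinite _)
        refine ⟨by grind, fun hle => (hle hx).2 (mem_insert _ _)⟩) hxA h rfl
      exact ⟨y, ⟨hy.1, fun h' => hy.2 (mem_insert_of_mem _ h')⟩, hyB⟩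

/-- The sets `S` with `A ⊆ S ⊆ B` that induce a connected subgraph of `G`. -/
def connectedBetween (G : SimpleGraph V) (A B : Set V) : Set (Set V) :=
  {S | A ⊆ S ∧ S ⊆ B ∧ (G.induce S).Connected}

theorem succ_ncard_diff_le_ncard_connectedBetween (hA : (G.induce A).Connected)
    (hB : (G.induce B).Connected) (hAB : A ⊆ B) :
    (B \ A).ncard + 1 ≤ (G.connectedBetween A B).ncard := by
  induction hk : (B \ A).ncard generalizing A with
  | zero =>
    rw [Nat.zero_add, Nat.one_le_iff_ne_zero, ← Nat.pos_iff_ne_zero, ncard_pos (toFinite _)]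
    exact ⟨A, Subset.rfl, hAB, hA⟩
  | succ k ih =>
    have hne : (B \ A).Nonempty := nonempty_of_ncard_ne_zero (by omega)
    obtain ⟨x, hx, hxA⟩ := exists_connected_induce_insert hA hB
      ⟨hAB, fun h => by obtain ⟨y, hy⟩ := hne; exact hy.2 (h hy.1)⟩
    have hcard : (B \ insert x A).ncard = k := by
      have : B \ insert x A = (B \ A) \ {x} := by grind
      rw [this, ncard_sdiff_singleton_of_mem hx, hk, Nat.add_sub_cancel]
    -- `A` itself lies between `A` and `B`, and is one more than those that contain `x`.
    have hnot : A ∉ G.connectedBetween (insert x A) B := fun h => hx.2 (h.1 (mem_insert _ _))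
    have hsub : insert A (G.connectedBetween (insert x A) B) ⊆ G.connectedBetween A B := by
      rintro S (rfl | hS)
      · exact ⟨Subset.rfl, hAB, hA⟩
      · exact ⟨(subset_insert _ _).trans hS.1, hS.2⟩
    have := ncard_le_ncard hsub (toFinite _)
    rw [ncard_insert_of_notMem hnot (toFinite _)] at this
    have := ih hxA (insert_subset hx.1 hAB) hcard
    omega

/-- The connected sets between `A` and `B` that avoid `x`, and those that contain `x`. -/
theorem ncard_connectedBetween_add_le {x : V} :
    (G.connectedBetween A (B \ {x})).ncard + (G.connectedBetween (insert x A) B).ncard ≤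
      (G.connectedBetween A B).ncard := by
  rw [← ncard_union_eq _ (toFinite _) (toFinite _)]
  · apply ncard_le_ncard _ (toFinite _)
    rintro S (hS | hS)
    · exact ⟨hS.1, hS.2.1.trans sdiff_subset, hS.2.2⟩
    · exact ⟨(subset_insert _ _).trans hS.1, hS.2⟩
  · rw [Set.disjoint_left]
    intro S hS hS'
    exact (hS.2.1 (hS'.1 (mem_insert _ _))).2 rfl

theorem choose_le_ncard_connectedBetween_empty (hB : (G.induce B).Connected) :
    (B.ncard + 1).choose 2 ≤ (G.connectedBetween ∅ B).ncard := by
  induction hk : B.ncard generalizing B with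
  | zero => simp
  | succ k ih =>
    obtain ⟨b, hb⟩ := (connected_induce_iff_exists_adj.1 hB).1
    have key : ∃ x ∈ B, k = 0 ∨ (G.induce (B \ {x})).Connected := by
      by_cases hs : {b} = B
      · subst hs
        exact ⟨b, rfl, Or.inl (by simpa using hk.symm)⟩
      · obtain ⟨x, hx, h⟩ := exists_connected_induce_diff_singleton
          (connected_induce_singleton b) hB ((singleton_subset_iff.2 hb).ssubset_of_ne hs)
        exact ⟨x, hx.1, Or.inr h⟩
    obtain ⟨x, hx, h⟩ := key
    have hcard : (B \ {x}).ncard = k := by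
      rw [ncard_sdiff_singleton_of_mem hx, hk, Nat.add_sub_cancel]
    have h1 : (k + 1).choose 2 ≤ (G.connectedBetween ∅ (B \ {x})).ncard := by
      rcases h with rfl | h
      · simp
      · exact ih h hcard
    have h2 := succ_ncard_diff_le_ncard_connectedBetween (connected_induce_singleton x) hB
      (singleton_subset_iff.2 hx)
    have h3 := ncard_connectedBetween_add_le (G := G) (A := ∅) (B := B) (x := x)
    rw [← insert_empty_eq] at h2
    rw [insert_empty_eq, hcard, ← insert_empty_eq] at h2
    have h4 : (k + 1 + 1).choose 2 = (k + 1) + (k + 1).choose 2 := by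
      rw [Nat.choose_succ_succ' (k + 1) 1, Nat.choose_one_right]
    omega

/-- If no vertex of `W` is a cut vertex of `A ∪ W`, then some neighbour of `A` in `W` is not a cut
vertex of `W`. Indeed, take a neighbour `u` of `A` and a connected `X ⊆ W \ {u}` with `X` as large
as possible. If `X ≠ W \ {u}`, then inside `W` only `u` is adjacent to `X`, so the rest of `W`
contains a neighbour `t` of `A`, and `(t, X ∪ {u})` is a larger choice. -/
theorem exists_adj_connected_diff_singleton (hA : A.Nonempty) (hAW : Disjoint A W)
    (hW : (G.induce W).Connected) (hW2 : 1 < W.ncard)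
    (h : ∀ u ∈ W, (G.induce ((A ∪ W) \ {u})).Connected) :
    ∃ u ∈ W, (∃ a ∈ A, G.Adj a u) ∧ (G.induce (W \ {u})).Connected := by
  rw [Set.disjoint_left] at hAW
  have hstep : ∀ u ∈ W, ∃ w ∈ W \ {u}, ∃ a ∈ A, G.Adj a w := by
    intro u hu
    obtain ⟨w, hw, hwu⟩ := exists_ne_of_one_lt_ncard hW2 u
    obtain ⟨a, ha, w, hw, haw⟩ := (connected_induce_iff_exists_adj.1 (h u hu)).2 A
      (fun a ha => ⟨Or.inl ha, fun h => hAW ha (h ▸ hu)⟩) hA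
      ⟨w, ⟨Or.inr hw, hwu⟩, fun h => hAW h hw⟩
    exact ⟨w, ⟨by grind, hw.1.2⟩, a, ha, haw⟩
  obtain ⟨w₀, hw₀, -⟩ := hstep _ (connected_induce_iff_exists_adj.1 hW).1.some_mem
  obtain ⟨u₀, hu₀, hu₀A⟩ := hstep w₀ hw₀.1
  let F : Set (V × Set V) := {p | p.1 ∈ W ∧ (∃ a ∈ A, G.Adj a p.1) ∧ p.2 ⊆ W \ {p.1} ∧
    (G.induce p.2).Connected}
  obtain ⟨⟨u, X⟩, ⟨hu, huA, hXW, hX⟩, hmax⟩ := (toFinite F).exists_maximalFor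
    (fun p => p.2.ncard) F ⟨(u₀, {w₀}), hu₀.1, hu₀A,
      singleton_subset_iff.2 ⟨hw₀.1, fun h => hu₀.2 h.symm⟩, connected_induce_singleton w₀⟩
  have hmax' : ∀ p ∈ F, p.2.ncard ≤ X.ncard := fun p hp => by
    by_contra hlt
    exact hlt (hmax hp (by simpa using (not_le.1 hlt).le))
  refine ⟨u, hu, huA, ?_⟩
  suffices X = W \ {u} from this ▸ hX
  by_contra hne
  have hXne := (connected_induce_iff_exists_adj.1 hX).1
  have hout : ∀ x ∈ X, ∀ y ∈ W \ X, G.Adj x y → y = u := by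
    intro x hx y hy hxy
    by_contra hyu
    have := hmax' (u, insert y X) ⟨hu, huA, insert_subset ⟨hy.1, hyu⟩ hXW,
      connected_induce_insert hX hx hxy⟩
    rw [ncard_insert_of_notMem hy.2 (toFinite _)] at this
    omega
  have hXu : u ∉ X := fun h => (hXW h).2 rfl
  obtain ⟨x, hx, y, hy, hxy⟩ := (connected_induce_iff_exists_adj.1 hW).2 X
    (hXW.trans sdiff_subset) hXne ⟨u, hu, hXu⟩
  obtain rfl := hout x hx y hy hxy
  obtain ⟨z, hz, hzX⟩ := exists_of_ssubset (hXW.ssubset_of_ne hne)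
  obtain ⟨s, hs, t, ht, hst⟩ := (connected_induce_iff_exists_adj.1 (h y hu)).2 (A ∪ X)
    (by grind) hA.inl ⟨z, ⟨Or.inr hz.1, hz.2⟩, fun h => h.elim (fun h => hAW h hz.1) hzX⟩
  have htW : t ∈ W := by grind
  have hsA : s ∈ A := by
    rcases hs with hs | hs
    · exact hs
    · exact absurd (hout s hs t ⟨htW, fun h => ht.2 (Or.inr h)⟩ hst) ht.1.2
  have := hmax' (t, insert y X) ⟨htW, ⟨s, hsA, hst⟩,
    insert_subset ⟨hu, fun h => ht.1.2 h.symm⟩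
      (fun v hv => ⟨(hXW hv).1, fun h => ht.2 (Or.inr ((show v = t from h) ▸ hv))⟩),
    connected_induce_insert hX hx hxy⟩
  rw [ncard_insert_of_notMem hXu (toFinite _)] at this
  omega

/-- If no vertex of `W` is a cut vertex of `A ∪ W`, then there are at least as many connected sets
between `A` and `A ∪ W` as when `A` is an arc of a cycle `A ∪ W`. -/
theorem succ_choose_le_ncard_connectedBetween_union (hA : (G.induce A).Connected)
    (hAW : Disjoint A W) (hW : (G.induce W).Connected) (hAW' : (G.induce (A ∪ W)).Connected)
    (h : ∀ u ∈ W, (G.induce ((A ∪ W) \ {u})).Connected) :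
    (W.ncard + 1).choose 2 + 1 ≤ (G.connectedBetween A (A ∪ W)).ncard := by
  induction hk : W.ncard generalizing A W with
  | zero =>
    rw [ncard_eq_zero (toFinite _)] at hk
    subst hk
    exact absurd (connected_induce_iff_exists_adj.1 hW).1 not_nonempty_empty
  | succ k ih =>
    have hA0 := (connected_induce_iff_exists_adj.1 hA).1
    have hd := Set.disjoint_left.1 hAW
    have h4 : (k + 1 + 1).choose 2 = (k + 1) + (k + 1).choose 2 := by
      rw [Nat.choose_succ_succ' (k + 1) 1, Nat.choose_one_right]
    rcases Nat.eq_zero_or_pos k with rfl | hk0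
    · have := succ_ncard_diff_le_ncard_connectedBetween hA hAW' subset_union_left
      rw [union_sdiff_cancel_left (by simp [hAW.inter_eq]), hk] at this
      simpa using this
    · obtain ⟨u, hu, ⟨a, ha, hau⟩, hWu⟩ :=
        exists_adj_connected_diff_singleton hA0 hAW hW (by omega) h
      have hun : insert u A ∪ W \ {u} = A ∪ W := by
        ext v
        by_cases hv : v = u
        · simp [hv, hu]
        · simp [hv]
      have hcard : (W \ {u}).ncard = k := by
        rw [ncard_sdiff_singleton_of_mem hu, hk, Nat.add_sub_cancel]
      have h1 := ih (A := insert u A) (W := W \ {u}) (connected_induce_insert hA ha hau)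
        (by rw [Set.disjoint_left]; grind) hWu (hun ▸ hAW')
        (fun v hv => hun ▸ h v hv.1) hcard
      rw [hun] at h1
      have h2 := succ_ncard_diff_le_ncard_connectedBetween hA (h u hu) (by grind)
      have h3 : ((A ∪ W) \ {u}) \ A = W \ {u} := by grind
      rw [h3, hcard] at h2
      have h5 := ncard_connectedBetween_add_le (G := G) (A := A) (B := A ∪ W) (x := u)
      omega

end ConnectedSets

/-! ### Pieces cut off by a vertex -/

section CutVertices

variable {V : Type*} {G : SimpleGraph V} {K S T : Set V} {c u w : V}

/-- To prove a set connected it suffices to consider the partitions through the part avoiding a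
fixed vertex `c`. -/
theorem connected_induce_of_exists_adj (hc : c ∈ S)
    (h : ∀ T ⊆ S, c ∉ T → T.Nonempty → ∃ x ∈ T, ∃ y ∈ S \ T, G.Adj x y) :
    (G.induce S).Connected := by
  refine connected_induce_iff_exists_adj.2 ⟨⟨c, hc⟩, fun T hT hT1 hT2 => ?_⟩
  by_cases hcT : c ∈ T
  · obtain ⟨x, hx, y, hy, hxy⟩ := h (S \ T) sdiff_subset (fun h => h.2 hcT) hT2
    rw [sdiff_sdiff_cancel_left hT] at hy
    exact ⟨y, hy, x, hx, hxy.symm⟩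
  · exact h T hT hcT hT1

/-- The vertex `c` separates `K` from the nonempty set of vertices outside `K ∪ {c}`. The set `K`
may consist of several components of `G - c`. -/
structure CutsOff (G : SimpleGraph V) (c : V) (K : Set V) : Prop where
  nonempty : K.Nonempty
  notMem : c ∉ K
  nonempty_rest : (insert c K)ᶜ.Nonempty
  eq_of_adj : ∀ x ∈ K, ∀ y ∉ K, G.Adj x y → y = c

theorem CutsOff.compl_insert (h : G.CutsOff c K) : G.CutsOff c (insert c K)ᶜ where
  nonempty := h.nonempty_rest
  notMem h := h (mem_insert _ _)
  nonempty_rest := by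
    obtain ⟨x, hx⟩ := h.nonempty
    have := h.notMem
    exact ⟨x, by grind⟩
  eq_of_adj x hx y hy hxy := by
    have := h.eq_of_adj y
    grind [hxy.symm]

theorem CutsOff.connected_induce_sdiff (h : G.CutsOff c K) (hS : (G.induce S).Connected)
    (hc : c ∈ S) : (G.induce (S \ K)).Connected := by
  refine connected_induce_of_exists_adj ⟨hc, h.notMem⟩ fun T hT hcT hT0 => ?_
  obtain ⟨x, hx, y, hy, hxy⟩ := (connected_induce_iff_exists_adj.1 hS).2 T
    (hT.trans sdiff_subset) hT0 ⟨c, hc, hcT⟩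
  refine ⟨x, hx, y, ⟨⟨hy.1, fun hyK => hcT ?_⟩, hy.2⟩, hxy⟩
  exact h.eq_of_adj y hyK x (hT hx).2 hxy.symm ▸ hx

theorem CutsOff.connected_induce_inter (h : G.CutsOff c K) (hS : (G.induce S).Connected)
    (hc : c ∈ S) : (G.induce (S ∩ insert c K)).Connected := by
  have := h.compl_insert.connected_induce_sdiff hS hc
  rwa [sdiff_compl] at this

theorem connected_induce_univ (hG : G.Connected) : (G.induce univ).Connected :=
  (induceUnivIso G).connected_iff.2 hG

theorem exists_cutsOff (hu : ¬ (G.induce {u}ᶜ).Connected) (hw : w ≠ u) :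
    ∃ K, G.CutsOff u K ∧ w ∉ K := by
  by_contra! hcon
  refine hu (connected_induce_of_exists_adj (c := w) hw fun T hT hwT hT0 => ?_)
  by_contra! hT'
  refine hwT (hcon T ⟨hT0, fun h => hT h rfl, ⟨w, ?_⟩, fun x hx y hy hxy => ?_⟩)
  · rintro (h | h)
    exacts [hw h, hwT h]
  · by_contra hyu
    exact hT' x hx y ⟨hyu, hy⟩ hxy

theorem CutsOff.not_connected (h : G.CutsOff c K) : ¬ (G.induce {c}ᶜ).Connected := by
  intro hc
  obtain ⟨z, hz⟩ := h.nonempty_rest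
  obtain ⟨x, hx, y, hy, hxy⟩ := (connected_induce_iff_exists_adj.1 hc).2 K
    (fun x hx hxc => h.notMem (hxc ▸ hx)) h.nonempty
    ⟨z, fun h => hz (Or.inl h), fun h => hz (Or.inr h)⟩
  exact hy.1 (h.eq_of_adj x hx y hy.2 hxy)

/-- Every set cut off by a vertex contains a connected one, cut off by a possibly different vertex,
that has no cut vertex of `G`: a smallest one will do. -/
theorem CutsOff.exists_minimal [Finite V] (hG : G.Connected) (h : G.CutsOff c K) :
    ∃ c' K', K' ⊆ K ∧ G.CutsOff c' K' ∧ (G.induce K').Connected ∧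
      ∀ u ∈ K', (G.induce {u}ᶜ).Connected := by
  -- Minimize `|K'|` over all pieces `K' ⊆ K`, whatever vertex cuts them off.
  let F : Set (V × Set V) := {p | p.2 ⊆ K ∧ G.CutsOff p.1 p.2}
  obtain ⟨⟨d, L⟩, ⟨hLK, hL⟩, hmin⟩ := (toFinite F).exists_minimalFor
    (fun p => p.2.ncard) F ⟨(c, K), Subset.rfl, h⟩
  have hmin' : ∀ d' L', L' ⊂ L → ¬ G.CutsOff d' L' := fun d' L' hL' h' => by
    have h1 : L'.ncard < L.ncard := ncard_lt_ncard hL' (toFinite _)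
    have h2 : L.ncard ≤ L'.ncard :=
      hmin (j := (d', L')) ⟨hL'.1.trans hLK, h'⟩ h1.le
    omega
  refine ⟨d, L, hLK, hL, connected_induce_iff_exists_adj.2
    ⟨hL.nonempty, fun T hT hT0 hT1 => ?_⟩, fun u hu => ?_⟩
  · by_contra! hcon
    refine hmin' d T (hT.ssubset_of_ne fun h => by simp [h] at hT1) ⟨hT0, fun h => hL.notMem (hT h),
      hL.nonempty_rest.mono (compl_subset_compl.2 (insert_subset_insert hT)), ?_⟩
    intro x hx y hy hxy
    by_cases hyL : y ∈ L
    · exact absurd hxy (hcon x hx y ⟨hyL, hy⟩)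
    · exact hL.eq_of_adj x (hT hx) y hyL hxy
  · by_contra hcon
    have hdu : d ≠ u := fun h => hL.notMem (h ▸ hu)
    obtain ⟨T, hT, hdT⟩ := exists_cutsOff hcon hdu
    -- If `u ∈ L` is a cut vertex, then the connected complement of `L` lies on the side of `d`,
    -- so the other side `T` is a smaller piece.
    have hLc := hL.connected_induce_sdiff (connected_induce_univ hG) (mem_univ d)
    refine hmin' u T ((ssubset_iff_of_subset fun x hxT => ?_).2 ⟨u, hu, hT.notMem⟩) hT
    by_contra hxL
    obtain ⟨a, ha, b, hb, hab⟩ := (connected_induce_iff_exists_adj.1 hLc).2 ((univ \ L) ∩ T)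
      inter_subset_left ⟨x, ⟨mem_univ _, hxL⟩, hxT⟩
      ⟨d, ⟨mem_univ _, hL.notMem⟩, fun h => hdT h.2⟩
    have := hT.eq_of_adj a ha.2 b (fun h => hb.2 ⟨hb.1, h⟩) hab
    exact hb.1.2 (this ▸ hu)

variable [Finite V]

/-- A graph without cut vertex has at least as many connected sets as a cycle of its order. -/
theorem mul_pred_add_one_le_ncard_of_no_cut (hG : G.Connected)
    (h : ∀ u, (G.induce {u}ᶜ).Connected) :
    Nat.card V * (Nat.card V - 1) + 1 ≤ (G.connectedBetween ∅ univ).ncard := by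
  obtain ⟨v⟩ := hG.nonempty
  have hcard : ({v}ᶜ : Set V).ncard + 1 = Nat.card V := by
    have := ncard_add_ncard_compl ({v} : Set V)
    rw [ncard_singleton] at this
    omega
  have h1 := choose_le_ncard_connectedBetween_empty (h v)
  have hun : ({v} ∪ {v}ᶜ : Set V) = univ := union_compl_self _
  have h2 := succ_choose_le_ncard_connectedBetween_union (connected_induce_singleton v)
    disjoint_compl_right (h v) (hun ▸ connected_induce_univ hG)
    (fun u _ => by rw [hun, ← compl_eq_univ_sdiff]; exact h u)
  have h3 := ncard_connectedBetween_add_le (G := G) (A := ∅) (B := univ) (x := v)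
  rw [← compl_eq_univ_sdiff, insert_empty_eq] at h3
  rw [hun] at h2
  rw [hcard] at h1 h2
  have h4 : (Nat.card V).choose 2 * 2 = Nat.card V * (Nat.card V - 1) := by
    rw [Nat.choose_two_right]
    exact Nat.div_two_mul_two_of_even (Nat.even_mul_pred_self _)
  omega

/-- There are at least `(|K| + 1).choose 2` ways to extend `{c}` to a connected set by vertices of a
piece `K` cut off by `c`, the empty extension excluded. -/
theorem CutsOff.choose_le_ncard (hG : G.Connected) (h : G.CutsOff c K)
    (hK : (G.induce K).Connected) (hK' : ∀ u ∈ K, (G.induce {u}ᶜ).Connected) :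
    (K.ncard + 1).choose 2 ≤ (G.connectedBetween {c} (insert c K) \ {{c}}).ncard := by
  have hins : (G.induce ({c} ∪ K)).Connected := by
    have := h.connected_induce_inter (connected_induce_univ hG) (mem_univ c)
    rwa [univ_inter, insert_eq] at this
  have h1 := succ_choose_le_ncard_connectedBetween_union (connected_induce_singleton c)
    (disjoint_singleton_left.2 h.notMem) hK hins (fun u hu => ?_)
  · have hmem : {c} ∈ G.connectedBetween {c} (insert c K) :=
      ⟨Subset.rfl, singleton_subset_iff.2 (mem_insert _ _), connected_induce_singleton c⟩
    rw [ncard_sdiff_singleton_of_mem hmem, insert_eq]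
    omega
  · have := h.connected_induce_inter (hK' u hu) (fun h' => h.notMem (h' ▸ hu))
    rwa [insert_eq, inter_comm, ← Set.sdiff_eq] at this

end CutVertices

/-! ### Graphs with two ends -/

section TwoEnds

variable {V : Type*} {G : SimpleGraph V} {c₁ c₂ : V} {K₁ K₂ : Set V}

/-- `K₁` and `K₂` are disjoint connected pieces, cut off by `c₁` and `c₂` and containing no cut
vertex of `G`. The vertices `c₁` and `c₂` may coincide. -/
structure TwoEnds (G : SimpleGraph V) (c₁ c₂ : V) (K₁ K₂ : Set V) : Prop where
  cutsOff₁ : G.CutsOff c₁ K₁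
  cutsOff₂ : G.CutsOff c₂ K₂
  disjoint : Disjoint K₁ K₂
  notMem₁ : c₁ ∉ K₂
  notMem₂ : c₂ ∉ K₁
  connected₁ : (G.induce K₁).Connected
  connected₂ : (G.induce K₂).Connected
  noncut₁ : ∀ u ∈ K₁, (G.induce {u}ᶜ).Connected
  noncut₂ : ∀ u ∈ K₂, (G.induce {u}ᶜ).Connected

theorem TwoEnds.symm (h : G.TwoEnds c₁ c₂ K₁ K₂) : G.TwoEnds c₂ c₁ K₂ K₁ :=
  ⟨h.cutsOff₂, h.cutsOff₁, h.disjoint.symm, h.notMem₂, h.notMem₁, h.connected₂, h.connected₁,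
    h.noncut₂, h.noncut₁⟩

theorem exists_twoEnds [Finite V] (hG : G.Connected) {u : V}
    (hu : ¬ (G.induce {u}ᶜ).Connected) (hV : 1 < Nat.card V) :
    ∃ c₁ c₂ K₁ K₂, G.TwoEnds c₁ c₂ K₁ K₂ := by
  have : Nontrivial V := Finite.one_lt_card_iff_nontrivial.1 hV
  obtain ⟨w, hw⟩ := exists_ne u
  obtain ⟨K, hK, -⟩ := exists_cutsOff hu hw
  obtain ⟨c₁, K₁, hK₁, h₁, h₁c, h₁n⟩ := hK.exists_minimal hG
  obtain ⟨c₂, K₂, hK₂, h₂, h₂c, h₂n⟩ := hK.compl_insert.exists_minimal hG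
  refine ⟨c₁, c₂, K₁, K₂, h₁, h₂, ?_, fun h => h₁.not_connected (h₂n _ h),
    fun h => h₂.not_connected (h₁n _ h), h₁c, h₂c, h₁n, h₂n⟩
  rw [Set.disjoint_left]
  exact fun x hx hx' => hK₂ hx' (Or.inr (hK₁ hx))

theorem CutsOff.two_le_ncard [Finite V] {c : V} {K : Set V} (h : G.CutsOff c K)
    (hdeg : ∀ u c, ∃ v, v ≠ c ∧ G.Adj u v) : 2 ≤ K.ncard := by
  obtain ⟨u, hu⟩ := h.nonempty
  obtain ⟨v, hvc, huv⟩ := hdeg u c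
  have hv : v ∈ K := by
    by_contra hv
    exact hvc (h.eq_of_adj u hu v hv huv)
  exact (one_lt_ncard (toFinite _)).2 ⟨u, hu, v, hv, huv.ne⟩

theorem TwoEnds.connected_middle (h : G.TwoEnds c₁ c₂ K₁ K₂) (hG : G.Connected) :
    (G.induce (K₁ ∪ K₂)ᶜ).Connected := by
  have := h.cutsOff₂.connected_induce_sdiff (h.cutsOff₁.connected_induce_sdiff
    (connected_induce_univ hG) (mem_univ _)) ⟨mem_univ _, h.notMem₂⟩
  rwa [sdiff_sdiff, ← compl_eq_univ_sdiff] at this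

theorem TwoEnds.mem_middle₁ (h : G.TwoEnds c₁ c₂ K₁ K₂) : c₁ ∈ (K₁ ∪ K₂)ᶜ := fun h' =>
  h'.elim h.cutsOff₁.notMem h.notMem₁

theorem TwoEnds.mem_middle₂ (h : G.TwoEnds c₁ c₂ K₁ K₂) : c₂ ∈ (K₁ ∪ K₂)ᶜ := fun h' =>
  h'.elim h.notMem₂ h.cutsOff₂.notMem

theorem TwoEnds.ncard_middle [Finite V] (h : G.TwoEnds c₁ c₂ K₁ K₂) :
    K₁.ncard + K₂.ncard + (K₁ ∪ K₂)ᶜ.ncard = Nat.card V := by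
  rw [← ncard_union_eq h.disjoint, ncard_add_ncard_compl]

variable [Finite V]

/-- The connected sets that meet `K₁` and the middle part but not `K₂`: glue at `c₁` a connected set
of the middle part and one of `K₁ ∪ {c₁}`. -/
theorem TwoEnds.mul_le_ncard_one (h : G.TwoEnds c₁ c₂ K₁ K₂) (hG : G.Connected) :
    (K₁ ∪ K₂)ᶜ.ncard * (K₁.ncard + 1).choose 2 ≤
      {S | (G.induce S).Connected ∧ (S \ (K₁ ∪ K₂)).Nonempty ∧ (S ∩ K₁).Nonempty ∧
        ¬ (S ∩ K₂).Nonempty}.ncard := by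
  set M := (K₁ ∪ K₂)ᶜ with hM
  have hM1 : (M \ {c₁}).ncard + 1 = M.ncard := ncard_sdiff_singleton_add_one h.mem_middle₁
  have h1 := succ_ncard_diff_le_ncard_connectedBetween (connected_induce_singleton c₁)
    (h.connected_middle hG) (singleton_subset_iff.2 h.mem_middle₁)
  rw [← hM, hM1] at h1
  have h2 := h.cutsOff₁.choose_le_ncard hG h.connected₁ h.noncut₁
  refine (Nat.mul_le_mul h1 h2).trans ?_
  rw [← ncard_prod]
  have hd := Set.disjoint_left.1 h.disjoint
  have hc1 := h.cutsOff₁.notMem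
  have hc2 := h.notMem₁
  refine ncard_le_ncard_of_injOn (fun p => p.1 ∪ p.2) ?_ ?_ (toFinite _)
  · rintro ⟨X, Y⟩ ⟨⟨hX1, hX2, hX⟩, ⟨hY1, hY2, hY⟩, hYne⟩
    simp only [singleton_subset_iff] at hX1 hY1 hX2 hX hY2 hY hYne
    refine ⟨induce_union_connected hX.preconnected hY.preconnected ⟨c₁, hX1, hY1⟩,
      ⟨c₁, Or.inl hX1, h.mem_middle₁⟩, ?_, ?_⟩
    · obtain ⟨y, hy, hyc⟩ : ∃ y ∈ Y, y ≠ c₁ := by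
        by_contra! hcon
        exact hYne (Set.eq_singleton_iff_unique_mem.2 ⟨hY1, hcon⟩)
      exact ⟨y, Or.inr hy, (hY2 hy).resolve_left hyc⟩
    · rintro ⟨z, hz, hz2⟩
      rcases hz with hz | hz
      · exact hX2 hz (Or.inr hz2)
      · rcases hY2 hz with rfl | hz'
        · exact hc2 hz2
        · exact hd hz' hz2
  · rintro ⟨X, Y⟩ ⟨⟨hX1, hX2, hX⟩, ⟨hY1, hY2, hY⟩, -⟩
      ⟨X', Y'⟩ ⟨⟨hX1', hX2', hX'⟩, ⟨hY1', hY2', hY'⟩, -⟩ heq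
    simp only [singleton_subset_iff] at *
    have hXM : ∀ x ∈ X, x ∉ K₁ := fun x hx h' => hX2 hx (Or.inl h')
    have hXM' : ∀ x ∈ X', x ∉ K₁ := fun x hx h' => hX2' hx (Or.inl h')
    have hh : ∀ x, x ∈ X ∨ x ∈ Y ↔ x ∈ X' ∨ x ∈ Y' := fun x => Set.ext_iff.1 heq x
    have hYK : ∀ x ∈ Y, x = c₁ ∨ x ∈ K₁ := fun x hx => hY2 hx
    have hYK' : ∀ x ∈ Y', x = c₁ ∨ x ∈ K₁ := fun x hx => hY2' hx
    clear heq hX2 hX2' hY2 hY2' hX hX' hY hY'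
    refine Prod.ext (Set.ext fun x => ?_) (Set.ext fun x => ?_)
    · grind
    · grind

/-- The connected sets that meet `K₁`, `K₂` and the middle part: glue three connected sets at `c₁`
and at `c₂`. -/
theorem TwoEnds.mul_le_ncard_both (h : G.TwoEnds c₁ c₂ K₁ K₂) (hG : G.Connected) :
    (G.connectedBetween {c₁, c₂} (K₁ ∪ K₂)ᶜ).ncard *
        ((K₁.ncard + 1).choose 2 * (K₂.ncard + 1).choose 2) ≤
      {S | (G.induce S).Connected ∧ (S \ (K₁ ∪ K₂)).Nonempty ∧ (S ∩ K₁).Nonempty ∧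
        (S ∩ K₂).Nonempty}.ncard := by
  have h1 := h.cutsOff₁.choose_le_ncard hG h.connected₁ h.noncut₁
  have h2 := h.cutsOff₂.choose_le_ncard hG h.connected₂ h.noncut₂
  refine (Nat.mul_le_mul_left _ (Nat.mul_le_mul h1 h2)).trans ?_
  rw [← ncard_prod, ← ncard_prod]
  have hd := Set.disjoint_left.1 h.disjoint
  have hc1 := h.cutsOff₁.notMem
  have hc2 := h.notMem₁
  have hc3 := h.cutsOff₂.notMem
  have hc4 := h.notMem₂
  refine ncard_le_ncard_of_injOn (fun p => p.1 ∪ p.2.1 ∪ p.2.2) ?_ ?_ (toFinite _)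
  · rintro ⟨X, Y, Z⟩ ⟨⟨hX1, hX2, hX⟩, ⟨⟨hY1, hY2, hY⟩, hYne⟩, ⟨hZ1, hZ2, hZ⟩, hZne⟩
    simp only [insert_subset_iff, singleton_subset_iff]
      at hX1 hY1 hX2 hX hY2 hY hYne hZ1 hZ2 hZ hZne
    refine ⟨induce_union_connected (induce_union_connected hX.preconnected hY.preconnected
      ⟨c₁, hX1.1, hY1⟩).preconnected hZ.preconnected ⟨c₂, Or.inl hX1.2, hZ1⟩,
      ⟨c₁, Or.inr hY1 |> Or.inl, h.mem_middle₁⟩, ?_, ?_⟩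
    · obtain ⟨y, hy, hyc⟩ : ∃ y ∈ Y, y ≠ c₁ := by
        by_contra! hcon
        exact hYne (Set.eq_singleton_iff_unique_mem.2 ⟨hY1, hcon⟩)
      exact ⟨y, Or.inl (Or.inr hy), (hY2 hy).resolve_left hyc⟩
    · obtain ⟨y, hy, hyc⟩ : ∃ y ∈ Z, y ≠ c₂ := by
        by_contra! hcon
        exact hZne (Set.eq_singleton_iff_unique_mem.2 ⟨hZ1, hcon⟩)
      exact ⟨y, Or.inr hy, (hZ2 hy).resolve_left hyc⟩
  · rintro ⟨X, Y, Z⟩ ⟨⟨hX1, hX2, hX⟩, ⟨⟨hY1, hY2, hY⟩, -⟩, ⟨hZ1, hZ2, hZ⟩, -⟩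
      ⟨X', Y', Z'⟩ ⟨⟨hX1', hX2', hX'⟩, ⟨⟨hY1', hY2', hY'⟩, -⟩, ⟨hZ1', hZ2', hZ'⟩, -⟩ heq
    simp only [insert_subset_iff, singleton_subset_iff] at *
    have hXM : ∀ x ∈ X, x ∉ K₁ ∧ x ∉ K₂ := fun x hx => not_or.1 (hX2 hx)
    have hXM' : ∀ x ∈ X', x ∉ K₁ ∧ x ∉ K₂ := fun x hx => not_or.1 (hX2' hx)
    have hh : ∀ x, (x ∈ X ∨ x ∈ Y) ∨ x ∈ Z ↔ (x ∈ X' ∨ x ∈ Y') ∨ x ∈ Z' :=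
      fun x => Set.ext_iff.1 heq x
    have hYK : ∀ x ∈ Y, x = c₁ ∨ x ∈ K₁ := fun x hx => hY2 hx
    have hYK' : ∀ x ∈ Y', x = c₁ ∨ x ∈ K₁ := fun x hx => hY2' hx
    have hZK : ∀ x ∈ Z, x = c₂ ∨ x ∈ K₂ := fun x hx => hZ2 hx
    have hZK' : ∀ x ∈ Z', x = c₂ ∨ x ∈ K₂ := fun x hx => hZ2' hx
    clear heq hX2 hX2' hY2 hY2' hX hX' hY hY' hZ hZ' hZ2 hZ2' h1 h2 h
    refine Prod.ext (Set.ext fun x => ?_) (Prod.ext (Set.ext fun x => ?_) (Set.ext fun x => ?_))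
    · dsimp only; grind
    · dsimp only; grind
    · dsimp only; grind

theorem TwoEnds.le_ncard (h : G.TwoEnds c₁ c₂ K₁ K₂) (hG : G.Connected) :
    ((K₁ ∪ K₂)ᶜ.ncard + 1).choose 2 +
      ((K₁ ∪ K₂)ᶜ.ncard + 1) * ((K₁.ncard + 1).choose 2 + (K₂.ncard + 1).choose 2) +
      (G.connectedBetween {c₁, c₂} (K₁ ∪ K₂)ᶜ).ncard *
        ((K₁.ncard + 1).choose 2 * (K₂.ncard + 1).choose 2) ≤
    {S | (G.induce S).Connected}.ncard := by
  have hMc := h.connected_middle hG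
  have h0 := choose_le_ncard_connectedBetween_empty hMc
  have h1 := choose_le_ncard_connectedBetween_empty h.connected₁
  have h2 := choose_le_ncard_connectedBetween_empty h.connected₂
  have h3 := h.mul_le_ncard_one hG
  have h4 := h.symm.mul_le_ncard_one hG
  have h5 := h.mul_le_ncard_both hG
  rw [union_comm K₂ K₁] at h4
  -- `M`, `A`, `B` collect the sets that meet the middle part, `K₁`, `K₂`, respectively.
  set P : Set (Set V) := {S | (G.induce S).Connected}
  let M : Set (Set V) := {S | (S \ (K₁ ∪ K₂)).Nonempty}
  let A : Set (Set V) := {S | (S ∩ K₁).Nonempty}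
  let B : Set (Set V) := {S | (S ∩ K₂).Nonempty}
  have hd := Set.disjoint_left.1 h.disjoint
  have e1 := ncard_inter_add_ncard_sdiff_eq_ncard P M (toFinite _)
  have e2 := ncard_inter_add_ncard_sdiff_eq_ncard (P ∩ M) A (toFinite _)
  have e3 := ncard_inter_add_ncard_sdiff_eq_ncard (P ∩ M ∩ A) B (toFinite _)
  have e4 := ncard_inter_add_ncard_sdiff_eq_ncard ((P ∩ M) \ A) B (toFinite _)
  have e5 := ncard_inter_add_ncard_sdiff_eq_ncard (P \ M) A (toFinite _)
  have g0 : (G.connectedBetween ∅ (K₁ ∪ K₂)ᶜ).ncard ≤ (((P ∩ M) \ A) \ B).ncard := by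
    refine ncard_le_ncard (fun S hS => ?_) (toFinite _)
    obtain ⟨x, hx⟩ := (connected_induce_iff_exists_adj.1 hS.2.2).1
    exact ⟨⟨⟨hS.2.2, x, hx, hS.2.1 hx⟩, fun ⟨y, hy, hy'⟩ => hS.2.1 hy (Or.inl hy')⟩,
      fun ⟨y, hy, hy'⟩ => hS.2.1 hy (Or.inr hy')⟩
  have g1 : (G.connectedBetween ∅ K₁).ncard ≤ ((P \ M) ∩ A).ncard := by
    refine ncard_le_ncard (fun S hS => ?_) (toFinite _)
    obtain ⟨x, hx⟩ := (connected_induce_iff_exists_adj.1 hS.2.2).1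
    exact ⟨⟨hS.2.2, fun ⟨y, hy, hy'⟩ => hy' (Or.inl (hS.2.1 hy))⟩, x, hx, hS.2.1 hx⟩
  have g2 : (G.connectedBetween ∅ K₂).ncard ≤ ((P \ M) \ A).ncard := by
    refine ncard_le_ncard (fun S hS => ?_) (toFinite _)
    exact ⟨⟨hS.2.2, fun ⟨y, hy, hy'⟩ => hy' (Or.inr (hS.2.1 hy))⟩,
      fun ⟨y, hy, hy'⟩ => hd hy' (hS.2.1 hy)⟩
  have g3 : {S | (G.induce S).Connected ∧ (S \ (K₁ ∪ K₂)).Nonempty ∧ (S ∩ K₁).Nonempty ∧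
        ¬ (S ∩ K₂).Nonempty} = (P ∩ M ∩ A) \ B := by
    ext S; simp only [mem_ofPred_eq, mem_inter_iff, mem_sdiff, P, M, A, B]; tauto
  have g4 : {S | (G.induce S).Connected ∧ (S \ (K₁ ∪ K₂)).Nonempty ∧ (S ∩ K₂).Nonempty ∧
        ¬ (S ∩ K₁).Nonempty} = ((P ∩ M) \ A) ∩ B := by
    ext S; simp only [mem_ofPred_eq, mem_inter_iff, mem_sdiff, P, M, A, B]; tauto
  have g5 : {S | (G.induce S).Connected ∧ (S \ (K₁ ∪ K₂)).Nonempty ∧ (S ∩ K₁).Nonempty ∧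
        (S ∩ K₂).Nonempty} = P ∩ M ∩ A ∩ B := by
    ext S; simp only [mem_ofPred_eq, mem_inter_iff, P, M, A, B]; tauto
  rw [g3] at h3
  rw [g4] at h4
  rw [g5] at h5
  have e : ((K₁ ∪ K₂)ᶜ.ncard + 1) * ((K₁.ncard + 1).choose 2 + (K₂.ncard + 1).choose 2) =
    (K₁ ∪ K₂)ᶜ.ncard * (K₁.ncard + 1).choose 2 + (K₁ ∪ K₂)ᶜ.ncard * (K₂.ncard + 1).choose 2 +
      (K₁.ncard + 1).choose 2 + (K₂.ncard + 1).choose 2 := by ring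
  omega

end TwoEnds

end SimpleGraph

/-! ### Minimizing the bound -/

/-- The lower bound in terms of the sizes `a`, `b` of the ends and `r` of the middle part is
smallest for `a = b = 2`. -/
theorem two_mul_bound_of_end_sizes {a b r t n N : ℕ} (ha : 2 ≤ a) (hb : 2 ≤ b) (hr : 1 ≤ r)
    (ht : 1 ≤ t) (hn : a + b + r = n)
    (hN : (r + 1).choose 2 + (r + 1) * ((a + 1).choose 2 + (b + 1).choose 2) +
      t * ((a + 1).choose 2 * (b + 1).choose 2) ≤ N) :
    (n - 1) * (n + 6) ≤ 2 * N ∧ (2 * N = (n - 1) * (n + 6) → a = 2 ∧ b = 2 ∧ t = 1) := by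
  obtain ⟨x, rfl⟩ := Nat.exists_eq_add_of_le ha
  obtain ⟨y, rfl⟩ := Nat.exists_eq_add_of_le hb
  obtain ⟨s, rfl⟩ := Nat.exists_eq_add_of_le hr
  obtain ⟨t, rfl⟩ := Nat.exists_eq_add_of_le ht
  subst hn
  have key : ∀ m : ℕ, 2 * (m + 1).choose 2 = (m + 1) * m := fun m => by
    rw [Nat.choose_two_right, Nat.add_sub_cancel]
    exact Nat.mul_div_cancel' (by rw [mul_comm]; exact (Nat.even_mul_succ_self m).two_dvd)
  have h1 := key (2 + x)
  have h2 := key (2 + y)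
  have h3 := key (1 + s)
  generalize (2 + x + 1).choose 2 = α at *
  generalize (2 + y + 1).choose 2 = β at *
  generalize (1 + s + 1).choose 2 = γ at *
  have e : 2 + x + (2 + y) + (1 + s) - 1 = s + x + y + 4 := by omega
  rw [e]
  have h4 : 4 * (α * β) = ((2 + x + 1) * (2 + x)) * ((2 + y + 1) * (2 + y)) := by
    rw [← h1, ← h2]; ring
  have h5 : 9 ≤ α * β := by
    have : 36 ≤ 4 * (α * β) := by
      rw [h4]
      have hx : 6 ≤ (2 + x + 1) * (2 + x) := by nlinarith
      have hy : 6 ≤ (2 + y + 1) * (2 + y) := by nlinarith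
      exact Nat.mul_le_mul hx hy
    omega
  -- In the excesses `x`, `y`, `s`, `t` of `a`, `b`, `r`, `t` over their minimal values, the
  -- difference of the two sides is a polynomial with nonnegative coefficients.
  have h6 : 2 * ((s + x + y + 4) * (2 + x + (2 + y) + (1 + s) + 6)) + 20 * x + 20 * y + 36 * t ≤
      4 * N := by
    have h7 : 4 * (γ + (1 + s + 1) * (α + β) + (1 + t) * (α * β)) =
        2 * (2 * γ) + 2 * ((1 + s + 1) * (2 * α + 2 * β)) + 4 * (α * β) + t * (4 * (α * β)) := by
      ring
    have h8 : 36 * t ≤ t * (4 * (α * β)) := by nlinarith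
    rw [h1, h2, h3] at h7
    have h9 : 2 * ((s + x + y + 4) * (2 + x + (2 + y) + (1 + s) + 6)) + 20 * x + 20 * y ≤
        2 * ((1 + s + 1) * (1 + s)) + 2 * ((1 + s + 1) * ((2 + x + 1) * (2 + x) +
          (2 + y + 1) * (2 + y))) + 4 * (α * β) := by
      rw [h4]
      ring_nf
      have : x * y * 4 ≤ x * y * 25 := by omega
      have : x * s * 4 ≤ x * s * 10 := by omega
      have : y * s * 4 ≤ y * s * 10 := by omega
      have : x ^ 2 * 2 ≤ x ^ 2 * 10 := by omega
      have : y ^ 2 * 2 ≤ y ^ 2 * 10 := by omega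
      omega
    omega
  constructor
  · omega
  · intro h
    omega

/-! ### The double tadpole graph -/

theorem doubleTadpole_adj_iff_of_lt {n l r : ℕ} {i j : Fin n} (hij : (i : ℕ) < j) :
    (doubleTadpole n l r).Adj i j ↔ (i : ℕ) + 1 = j ∨ ((i : ℕ) = 0 ∧ (j : ℕ) + 1 = l) ∨
      ((i : ℕ) + r = n ∧ (j : ℕ) + 1 = n) := by
  have hne : i ≠ j := fun h => by simp [h] at hij
  have hj := j.2
  simp only [doubleTadpole, SimpleGraph.fromRel_adj, hne, ne_eq, not_false_eq_true, true_and]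
  constructor
  · rintro (h | h)
    · exact h
    · omega
  · exact Or.inl

theorem doubleTadpole_connected {n l r : ℕ} (hn : 0 < n) : (doubleTadpole n l r).Connected := by
  obtain ⟨m, rfl⟩ := Nat.exists_eq_succ_of_ne_zero hn.ne'
  refine (SimpleGraph.pathGraph_connected m).mono fun i j h => ?_
  rw [SimpleGraph.pathGraph_adj] at h
  rcases h with h | h
  · exact (doubleTadpole_adj_iff_of_lt (by omega)).2 (Or.inl h)
  · exact ((doubleTadpole_adj_iff_of_lt (by omega)).2 (Or.inl h)).symm

theorem doubleTadpole_not_isPendant {n : ℕ} (hn : 5 < n) (v : Fin n) :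
    ¬ IsPendant (doubleTadpole n 3 3) v := by
  classical
  have key : ∃ a b, (doubleTadpole n 3 3).Adj v a ∧ (doubleTadpole n 3 3).Adj v b ∧ a ≠ b := by
    have hv := v.2
    by_cases h0 : (v : ℕ) = 0
    · refine ⟨⟨1, by omega⟩, ⟨2, by omega⟩, ?_, ?_, by simp [Fin.ext_iff]⟩
      · exact (doubleTadpole_adj_iff_of_lt (by simp; omega)).2 (by simp; omega)
      · exact (doubleTadpole_adj_iff_of_lt (by simp; omega)).2 (by simp; omega)
    by_cases h1 : (v : ℕ) + 1 = n
    · refine ⟨⟨n - 2, by omega⟩, ⟨n - 3, by omega⟩, ?_, ?_, by simp [Fin.ext_iff]; omega⟩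
      · exact ((doubleTadpole_adj_iff_of_lt (by simp; omega)).2 (by simp; omega)).symm
      · exact ((doubleTadpole_adj_iff_of_lt (by simp; omega)).2 (by simp; omega)).symm
    · refine ⟨⟨v - 1, by omega⟩, ⟨v + 1, by omega⟩, ?_, ?_, by simp [Fin.ext_iff]⟩
      · exact ((doubleTadpole_adj_iff_of_lt (by simp; omega)).2 (by simp; omega)).symm
      · exact (doubleTadpole_adj_iff_of_lt (by simp)).2 (by simp)
  obtain ⟨a, b, ha, hb, hab⟩ := key
  intro h
  obtain ⟨w, -, hw⟩ := SimpleGraph.degree_eq_one_iff_existsUnique_adj.1 h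
  exact hab ((hw a ha).trans (hw b hb).symm)

theorem isConnectedWithPendants_doubleTadpole {n : ℕ} (hn : 5 < n) :
    IsConnectedWithPendants (doubleTadpole n 3 3) n 0 where
  connected := doubleTadpole_connected (by omega)
  order := Fintype.card_fin n
  pendants := by
    rw [ncard_eq_zero (toFinite _), eq_empty_iff_forall_notMem]
    exact doubleTadpole_not_isPendant hn

/-- In `D_n`, a connected set with minimum `a` and maximum `b` can only skip a vertex between them
that is bypassed by the edge `{0, 2}` or the edge `{n - 3, n - 1}`. -/
theorem eq_of_notMem_of_connected_doubleTadpole {n : ℕ} {S : Set (Fin n)}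
    (hS : ((doubleTadpole n 3 3).induce S).Connected) {a m b : Fin n} (ha : a ∈ S) (hb : b ∈ S)
    (ham : a < m) (hmb : m < b) (hm : m ∉ S) (hb' : ∀ x ∈ S, x ≤ b) (ha' : ∀ x ∈ S, a ≤ x) :
    ((m : ℕ) = 1 ∧ (a : ℕ) = 0) ∨ ((m : ℕ) + 2 = n ∧ (b : ℕ) + 1 = n) := by
  obtain ⟨x, hx, y, hy, hxy⟩ := (SimpleGraph.connected_induce_iff_exists_adj.1 hS).2
    {x | x ∈ S ∧ x < m} (fun x hx => hx.1) ⟨a, ha, ham⟩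
    ⟨b, hb, fun h => absurd hmb (not_lt.2 h.2.le)⟩
  have hmy : m < y := lt_of_le_of_ne (not_lt.1 fun h => hy.2 ⟨hy.1, h⟩) fun h => hm (h ▸ hy.1)
  have hxm := hx.2
  have hyb := hb' y hy.1
  have hax := ha' x hx.1
  rw [Fin.lt_def] at hmy hxm
  rw [Fin.le_def] at hyb hax
  rw [doubleTadpole_adj_iff_of_lt (by omega)] at hxy
  have := b.2
  omega

/-- A connected set of `D_n` is an interval `[a, b]`, an interval `[0, b]` without `1`, an interval
`[a, n - 1]` without `n - 2`, or `{0, …, n - 1}` without `1` and `n - 2`. -/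
theorem two_mul_numConnectedInduced_doubleTadpole_le {n : ℕ} (hn : 5 < n) :
    2 * numConnectedInduced (doubleTadpole n 3 3) ≤ (n - 1) * (n + 6) := by
  let p : Fin n := ⟨1, by omega⟩
  let q : Fin n := ⟨n - 2, by omega⟩
  let o : Fin n := ⟨0, by omega⟩
  let e : Fin n := ⟨n - 1, by omega⟩
  let T₁ : Set (Set (Fin n)) := (fun s : Sym2 (Fin n) => Icc s.inf s.sup) '' univ
  let T₂ : Set (Set (Fin n)) := (fun j => Icc o j \ {p}) '' ({o, p} : Set (Fin n))ᶜ
  let T₃ : Set (Set (Fin n)) := (fun i => Icc i e \ {q}) '' ({q, e} : Set (Fin n))ᶜ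
  have hsub : {S | ((doubleTadpole n 3 3).induce S).Connected} ⊆
      T₁ ∪ T₂ ∪ T₃ ∪ {(Icc o e \ {p}) \ {q}} := by
    intro S hS
    have hne := (SimpleGraph.connected_induce_iff_exists_adj.1 hS).1
    obtain ⟨a, ha, ha'⟩ := exists_min_image S id (toFinite S) hne
    obtain ⟨b, hb, hb'⟩ := exists_max_image S id (toFinite S) hne
    simp only [id] at ha' hb'
    have hab := ha' b hb
    have hgap : ∀ m, m ∉ S → a ≤ m → m ≤ b → (m = p ∧ a = o) ∨ (m = q ∧ b = e) := by
      intro m hm ham hmb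
      have h1 : a < m := lt_of_le_of_ne ham fun h => hm (h ▸ ha)
      have h2 : m < b := lt_of_le_of_ne hmb fun h => hm (h ▸ hb)
      have := eq_of_notMem_of_connected_doubleTadpole hS ha hb h1 h2 hm hb' ha'
      simp only [Fin.ext_iff, p, q, o, e]
      omega
    have hpq : p ≠ q := by simp [p, q, Fin.ext_iff]; omega
    by_cases h1 : p ∉ S ∧ a ≤ p ∧ p ≤ b
    · obtain rfl : a = o := by
        rcases hgap p h1.1 h1.2.1 h1.2.2 with h | h
        exacts [h.2, absurd h.1 hpq]
      by_cases h2 : q ∉ S ∧ o ≤ q ∧ q ≤ b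
      · obtain rfl : b = e := by
          rcases hgap q h2.1 h2.2.1 h2.2.2 with h | h
          exacts [absurd h.1.symm hpq, h.2]
        refine Or.inr ?_
        ext x
        have := hgap x
        have := ha' x
        have := hb' x
        simp only [mem_sdiff, mem_Icc, mem_singleton_iff]
        grind
      · refine Or.inl (Or.inl (Or.inr ⟨b, ?_, ?_⟩))
        · rintro (h | h)
          · have := h1.2.2
            rw [h] at this
            simp [p, o, Fin.le_def] at this
          · exact h1.1 (h ▸ hb)
        · ext x
          have := hgap x
          have := ha' x
          have := hb' x
          simp only [mem_sdiff, mem_Icc, mem_singleton_iff]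
          grind
    · by_cases h2 : q ∉ S ∧ a ≤ q ∧ q ≤ b
      · obtain rfl : b = e := by
          rcases hgap q h2.1 h2.2.1 h2.2.2 with h | h
          exacts [absurd h.1.symm hpq, h.2]
        refine Or.inl (Or.inr ⟨a, ?_, ?_⟩)
        · rintro (h | h)
          · exact h2.1 (h ▸ ha)
          · have := h2.2.1
            rw [h] at this
            simp [q, e, Fin.le_def] at this
            omega
        · ext x
          have := hgap x
          have := ha' x
          have := hb' x
          simp only [mem_sdiff, mem_Icc, mem_singleton_iff]
          grind
      · refine Or.inl (Or.inl (Or.inl ⟨s(a, b), mem_univ _, ?_⟩))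
        ext x
        have := hgap x
        have := ha' x
        have := hb' x
        simp only [Sym2.inf_mk, Sym2.sup_mk, mem_Icc, inf_eq_left.2 hab, sup_eq_right.2 hab]
        grind
  have hcard : ∀ x y : Fin n, x ≠ y → ({x, y} : Set (Fin n))ᶜ.ncard = n - 2 := fun x y hxy => by
    rw [ncard_compl, ncard_pair hxy, Nat.card_fin]
  have h1 : T₁.ncard ≤ (n + 1).choose 2 := by
    refine (ncard_image_le (toFinite _)).trans ?_
    rw [ncard_univ, Nat.card_eq_fintype_card, Sym2.card, Fintype.card_fin]
  have h2 : T₂.ncard ≤ n - 2 := (ncard_image_le (toFinite _)).trans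
    (hcard o p (by simp [o, p, Fin.ext_iff])).le
  have h3 : T₃.ncard ≤ n - 2 := (ncard_image_le (toFinite _)).trans
    (hcard q e (by simp [q, e, Fin.ext_iff]; omega)).le
  have h4 := ncard_le_ncard hsub (toFinite _)
  have h5 := ncard_union_le (T₁ ∪ T₂ ∪ T₃) {(Icc o e \ {p}) \ {q}}
  have h6 := ncard_union_le (T₁ ∪ T₂) T₃
  have h7 := ncard_union_le T₁ T₂
  rw [ncard_singleton] at h5
  have h8 : 2 * (n + 1).choose 2 = (n + 1) * n := by
    rw [Nat.choose_two_right, Nat.add_sub_cancel]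
    exact Nat.mul_div_cancel' (by rw [mul_comm]; exact (Nat.even_mul_succ_self n).two_dvd)
  change numConnectedInduced (doubleTadpole n 3 3) ≤ _ at h4
  obtain ⟨m, rfl⟩ := Nat.exists_eq_add_of_lt hn
  have h9 : (5 + m + 1 - 1) * (5 + m + 1 + 6) =
      (5 + m + 1 + 1) * (5 + m + 1) + 4 * (5 + m + 1 - 2) + 2 := by
    simp only [Nat.add_sub_cancel, show 5 + m + 1 - 2 = m + 4 by omega]
    ring
  omega

namespace SimpleGraph

/-! ### Recognizing the double tadpole graph -/

section Recognition

variable {V : Type*}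

/-- If only the whole vertex set is a connected set containing both `a` and `b`, then the graph is a
path from `a` to `b`. The labels `p i` with `i ≥ Nat.card V` carry no information. -/
theorem Connected.exists_path_labelling [Finite V] {H : SimpleGraph V} (hH : H.Connected) (a b : V)
    (hab : ∀ S : Set V, a ∈ S → b ∈ S → (H.induce S).Connected → S = univ) :
    ∃ p : ℕ → V, p 0 = a ∧ p (Nat.card V - 1) = b ∧ (∀ v, ∃ i < Nat.card V, p i = v) ∧
      ∀ i j, i < j → j < Nat.card V → (p i ≠ p j ∧ (H.Adj (p i) (p j) ↔ i + 1 = j)) := by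
  -- The support of a shortest path is connected, hence everything; a shortest path has no chord.
  obtain ⟨w, hw, hlen⟩ := hH.exists_path_of_dist a b
  have hsup : {v | v ∈ w.support} = univ :=
    hab _ w.start_mem_support w.end_mem_support w.connected_induce_support
  have hmem : ∀ v, v ∈ w.support := fun v => (Set.ext_iff.1 hsup v).2 (mem_univ v)
  have hinj := hw.getVert_injOn
  have hcard : Nat.card V = w.length + 1 := by
    have h2 : (w.getVert '' {i | i ≤ w.length}) = univ := by
      refine eq_univ_of_forall fun v => ?_
      obtain ⟨i, hi, hi'⟩ := Walk.mem_support_iff_exists_getVert.1 (hmem v)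
      exact ⟨i, hi', hi⟩
    rw [← ncard_univ, ← h2, hinj.ncard_image]
    have : {i | i ≤ w.length} = ((Finset.range (w.length + 1) : Finset ℕ) : Set ℕ) := by
      ext i; simp
    rw [this, ncard_coe_finset, Finset.card_range]
  refine ⟨w.getVert, w.getVert_zero, by rw [hcard]; exact w.getVert_length, fun v => ?_,
    fun i j hij hj => ⟨fun h => ?_, fun h => ?_, ?_⟩⟩
  · obtain ⟨i, hi, hi'⟩ := Walk.mem_support_iff_exists_getVert.1 (hmem v)
    exact ⟨i, by omega, hi⟩
  · have := hinj (show i ≤ w.length by omega) (show j ≤ w.length by omega) h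
    omega
  · by_contra hne
    -- An edge from `p i` to `p j` with `i + 1 < j` would be a shortcut.
    have h1 := H.dist_le ((w.take i).append ((w.drop j).cons h))
    rw [Walk.length_append, Walk.length_cons, Walk.take_length, Walk.drop_length, ← hlen] at h1
    omega
  · rintro rfl
    exact w.adj_getVert_succ (by omega)

variable {G : SimpleGraph V}

/-- Without pendant vertices, a piece of two vertices cut off by `c` forms a triangle with `c`. -/
theorem CutsOff.exists_eq_pair {c : V} {K : Set V} (h : G.CutsOff c K)
    (hdeg : ∀ u c, ∃ v, v ≠ c ∧ G.Adj u v) (hK : K.ncard = 2) :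
    ∃ x y, K = {x, y} ∧ G.Adj x y ∧ G.Adj x c ∧ G.Adj y c := by
  obtain ⟨x, y, hxy, rfl⟩ := ncard_eq_two.1 hK
  have key : ∀ x' y', ({x, y} : Set V) = {x', y'} → G.Adj x' c ∧ G.Adj x' y' := by
    intro x' y' heq
    rw [heq] at h
    have hx : x' ∈ ({x', y'} : Set V) := mem_insert _ _
    obtain ⟨v, hv, hxv⟩ := hdeg x' y'
    obtain ⟨u, hu, hxu⟩ := hdeg x' c
    constructor
    · have := h.eq_of_adj x' hx v (fun hv' => hv'.elim (fun h' => hxv.ne h'.symm) hv) hxv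
      exact this ▸ hxv
    · by_cases huK : u ∈ ({x', y'} : Set V)
      · obtain rfl : u = y' := huK.elim (fun h' => absurd h'.symm hxu.ne) id
        exact hxu
      · exact absurd (h.eq_of_adj x' hx u huK hxu) hu
  have h1 := key x y rfl
  have h2 := key y x (pair_comm x y)
  exact ⟨x, y, rfl, h1.2, h1.1, h2.1⟩

variable {c₁ c₂ : V} {K₁ K₂ : Set V}

theorem Hom.connected_induce_image {W : Type*} {H : SimpleGraph W} (f : G →g H) {S : Set V}
    (hS : (G.induce S).Connected) : (H.induce (f '' S)).Connected :=
  hS.map (induceHom f (mapsTo_image f S)) (by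
    rintro ⟨_, x, hx, rfl⟩
    exact ⟨⟨x, hx⟩, rfl⟩)

theorem Iso.numConnectedInduced_eq {W : Type*} {H : SimpleGraph W} (e : G ≃g H) :
    numConnectedInduced G = numConnectedInduced H := by
  unfold numConnectedInduced
  rw [← ncard_image_of_injective _ e.toEquiv.injective.image_injective]
  congr 1
  ext S
  constructor
  · rintro ⟨T, hT, rfl⟩
    exact e.toHom.connected_induce_image hT
  · intro hS
    refine ⟨e.symm '' S, e.symm.toHom.connected_induce_image hS, ?_⟩
    ext x
    simp

theorem TwoEnds.nonempty_iso [Finite V] (h : G.TwoEnds c₁ c₂ K₁ K₂) (hG : G.Connected)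
    (hdeg : ∀ u c, ∃ v, v ≠ c ∧ G.Adj u v) (h₁ : K₁.ncard = 2) (h₂ : K₂.ncard = 2)
    (hM : (G.connectedBetween {c₁, c₂} (K₁ ∪ K₂)ᶜ).ncard = 1) {n : ℕ} (hn : Nat.card V = n) :
    Nonempty (G ≃g doubleTadpole n 3 3) := by
  have hcard := h.ncard_middle
  have hMc := h.connected_middle hG
  have hm₁ := h.mem_middle₁
  have hm₂ := h.mem_middle₂
  set M := (K₁ ∪ K₂)ᶜ with hMdef
  set r := M.ncard with hr
  have hrpos : 0 < r := (ncard_pos (toFinite _)).2 ⟨c₁, hm₁⟩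
  have hMr : Nat.card M = r := rfl
  obtain ⟨S₀, hS₀⟩ := ncard_eq_one.1 hM
  have huniq : ∀ S : Set M, ⟨c₁, hm₁⟩ ∈ S → ⟨c₂, hm₂⟩ ∈ S →
      ((G.induce M).induce S).Connected → S = univ := by
    intro S hS1 hS2 hS
    have e1 : Subtype.val '' S ∈ G.connectedBetween {c₁, c₂} M := by
      refine ⟨?_, Subtype.coe_image_subset M S, ?_⟩
      · rintro x (rfl | rfl)
        exacts [⟨_, hS1, rfl⟩, ⟨_, hS2, rfl⟩]
      · exact (Embedding.induce M).toHom.connected_induce_image hS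
    have e2 : M ∈ G.connectedBetween {c₁, c₂} M := by
      refine ⟨?_, Subset.rfl, hMc⟩
      rintro x (rfl | rfl)
      exacts [hm₁, hm₂]
    rw [hS₀, mem_singleton_iff] at e1 e2
    refine eq_univ_of_forall fun x => ?_
    have : (x : V) ∈ Subtype.val '' S := by rw [e1, ← e2]; exact x.2
    obtain ⟨y, hy, hyx⟩ := this
    exact Subtype.ext hyx ▸ hy
  obtain ⟨p, hp0, hp1, hps, hpa⟩ := hMc.exists_path_labelling _ _ huniq
  rw [hMr] at hp1 hps hpa
  obtain ⟨x, y, hK₁, hxy, hxc, hyc⟩ := h.cutsOff₁.exists_eq_pair hdeg h₁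
  obtain ⟨z, w, hK₂, hzw, hzc, hwc⟩ := h.cutsOff₂.exists_eq_pair hdeg h₂
  have hx : x ∈ K₁ := by simp [hK₁]
  have hy : y ∈ K₁ := by simp [hK₁]
  have hz : z ∈ K₂ := by simp [hK₂]
  have hw : w ∈ K₂ := by simp [hK₂]
  have hd := Set.disjoint_left.1 h.disjoint
  have hpK₁ : ∀ i, (p i : V) ∉ K₁ := fun i hi => (p i).2 (Or.inl hi)
  have hpK₂ : ∀ i, (p i : V) ∉ K₂ := fun i hi => (p i).2 (Or.inr hi)
  have hpc₁ : ∀ i < r, ((p i : V) = c₁ ↔ i = 0) := by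
    intro i hi
    have e1 : (p 0 : V) = c₁ := by rw [hp0]
    constructor
    · intro hic
      by_contra hi0
      exact (hpa 0 i (by omega) hi).1 (Subtype.ext (e1.trans hic.symm))
    · rintro rfl; exact e1
  have hpc₂ : ∀ i < r, ((p i : V) = c₂ ↔ i + 1 = r) := by
    intro i hi
    have e1 : (p (r - 1) : V) = c₂ := by rw [hp1]
    constructor
    · intro hic
      by_contra hi0
      exact (hpa i (r - 1) (by omega) (by omega)).1 (Subtype.ext (hic.trans e1.symm))
    · intro hi; rw [← e1]; congr; omega
  -- adjacency of a vertex of an end to a vertex outside this end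
  have hout₁ : ∀ u ∈ K₁, ∀ v ∉ K₁, G.Adj u v ↔ v = c₁ := by
    intro u hu v hv
    refine ⟨h.cutsOff₁.eq_of_adj u hu v hv, ?_⟩
    rintro rfl
    rw [hK₁] at hu
    rcases hu with rfl | rfl <;> assumption
  have hout₂ : ∀ u ∈ K₂, ∀ v ∉ K₂, G.Adj u v ↔ v = c₂ := by
    intro u hu v hv
    refine ⟨h.cutsOff₂.eq_of_adj u hu v hv, ?_⟩
    rintro rfl
    rw [hK₂] at hu
    rcases hu with rfl | rfl <;> assumption
  -- `K₁` gets the labels `0, 1`, the path `M` the labels `2, …, r + 1`, and `K₂` the last two.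
  let f : ℕ → V := fun i => if i = 0 then x else if i = 1 then y else
    if i < r + 2 then p (i - 2) else if i = r + 2 then z else w
  have f0 : f 0 = x := rfl
  have f1 : f 1 = y := rfl
  have fp : ∀ i < r, f (i + 2) = p i := fun i hi => by simp [f, hi]
  have fz : f (r + 2) = z := by simp [f]
  have fw : f (r + 3) = w := by simp [f]
  have hnr : n = r + 4 := by omega
  have hadj : ∀ i j, i < j → j < n → (G.Adj (f i) (f j) ↔
      i + 1 = j ∨ (i = 0 ∧ j + 1 = 3) ∨ (i + 3 = n ∧ j + 1 = n)) := by
    have hidx : ∀ i < n, i = 0 ∨ i = 1 ∨ (∃ k < r, i = k + 2) ∨ i = r + 2 ∨ i = r + 3 := by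
      intro i hi
      by_cases h2 : 2 ≤ i ∧ i < r + 2
      · exact Or.inr (Or.inr (Or.inl ⟨i - 2, by omega, by omega⟩))
      · omega
    intro i j hij hj
    rcases hidx i (by omega) with rfl | rfl | ⟨k, hk, rfl⟩ | rfl | rfl <;>
      rcases hidx j hj with rfl | rfl | ⟨l, hl, rfl⟩ | rfl | rfl <;> try omega
    · rw [f0, f1]; simp [hxy]
    · rw [f0, fp l hl, hout₁ x hx _ (hpK₁ l), hpc₁ l hl]; omega
    · rw [f0, fz, hout₁ x hx _ fun h' => hd h' hz]
      exact iff_of_false (fun h' => h.notMem₁ (h' ▸ hz)) (by omega)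
    · rw [f0, fw, hout₁ x hx _ fun h' => hd h' hw]
      exact iff_of_false (fun h' => h.notMem₁ (h' ▸ hw)) (by omega)
    · rw [f1, fp l hl, hout₁ y hy _ (hpK₁ l), hpc₁ l hl]; omega
    · rw [f1, fz, hout₁ y hy _ fun h' => hd h' hz]
      exact iff_of_false (fun h' => h.notMem₁ (h' ▸ hz)) (by omega)
    · rw [f1, fw, hout₁ y hy _ fun h' => hd h' hw]
      exact iff_of_false (fun h' => h.notMem₁ (h' ▸ hw)) (by omega)
    · rw [fp k hk, fp l hl, ← induce_adj, (hpa k l (by omega) hl).2]; omega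
    · rw [fp k hk, fz, G.adj_comm, hout₂ z hz _ (hpK₂ k), hpc₂ k hk]; omega
    · rw [fp k hk, fw, G.adj_comm, hout₂ w hw _ (hpK₂ k), hpc₂ k hk]; omega
    · rw [fz, fw]; simp [hzw]
  have hsurj : ∀ v, ∃ i < n, f i = v := by
    intro v
    by_cases hv₁ : v ∈ K₁
    · rw [hK₁] at hv₁
      rcases hv₁ with rfl | rfl
      exacts [⟨0, by omega, f0⟩, ⟨1, by omega, f1⟩]
    by_cases hv₂ : v ∈ K₂
    · rw [hK₂] at hv₂
      rcases hv₂ with rfl | rfl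
      exacts [⟨r + 2, by omega, fz⟩, ⟨r + 3, by omega, fw⟩]
    obtain ⟨i, hi, hi'⟩ := hps ⟨v, not_or.2 ⟨hv₁, hv₂⟩⟩
    exact ⟨i + 2, by omega, by rw [fp i hi, hi']⟩
  have hbij : Function.Bijective (fun i : Fin n => f i) := by
    refine Function.Surjective.bijective_of_nat_card_le (fun v => ?_) (by simp [hn])
    obtain ⟨i, hi, hi'⟩ := hsurj v
    exact ⟨⟨i, hi⟩, hi'⟩
  refine ⟨RelIso.symm ⟨Equiv.ofBijective _ hbij, fun {i j} => ?_⟩⟩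
  simp only [Equiv.ofBijective_apply]
  rcases lt_trichotomy (i : ℕ) j with hij | hij | hij
  · rw [hadj i j hij j.2, doubleTadpole_adj_iff_of_lt hij]
  · rw [Fin.ext hij]; simp
  · rw [G.adj_comm, SimpleGraph.adj_comm _ i j, hadj j i hij i.2, doubleTadpole_adj_iff_of_lt hij]

end Recognition

end SimpleGraph

/-! ### Graphs without pendant vertices -/

/-- A connected graph without pendant vertices has minimum degree at least `2`. -/
theorem IsConnectedWithPendants.exists_ne_adj {V : Type*} [Fintype V] {G : SimpleGraph V} {n : ℕ}
    (h : IsConnectedWithPendants G n 0) (hn : 1 < n) (u c : V) : ∃ v, v ≠ c ∧ G.Adj u v := by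
  classical
  have : Nontrivial V := Fintype.one_lt_card_iff_nontrivial.1 (h.order ▸ hn)
  obtain ⟨v, hv⟩ := h.connected.preconnected.exists_adj_of_nontrivial u
  by_contra! hcon
  have hvc : ∀ w, G.Adj u w → w = c := fun w hw => by
    by_contra hwc
    exact hcon w hwc hw
  have h0 := (ncard_eq_zero (toFinite _)).1 h.pendants
  refine (eq_empty_iff_forall_notMem.1 h0) u ?_
  exact SimpleGraph.degree_eq_one_iff_existsUnique_adj.2 ⟨c, hvc v hv ▸ hv, hvc⟩

theorem IsConnectedWithPendants.le_two_mul_numConnectedInduced {V : Type*} [Fintype V]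
    {G : SimpleGraph V} {n : ℕ} (h : IsConnectedWithPendants G n 0) (hn : 5 < n) :
    (n - 1) * (n + 6) ≤ 2 * numConnectedInduced G ∧
      (2 * numConnectedInduced G = (n - 1) * (n + 6) →
        Nonempty (G ≃g doubleTadpole n 3 3)) := by
  have hG := h.connected
  have hV : Nat.card V = n := by rw [Nat.card_eq_fintype_card, h.order]
  by_cases hcut : ∀ u, (G.induce {u}ᶜ).Connected
  · have h1 := SimpleGraph.mul_pred_add_one_le_ncard_of_no_cut hG hcut
    have h2 : G.connectedBetween ∅ univ = {S | (G.induce S).Connected} := by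
      ext S; simp [SimpleGraph.connectedBetween]
    rw [h2, hV] at h1
    change _ ≤ numConnectedInduced G at h1
    have h3 : (n - 1) * (n + 6) < 2 * (n * (n - 1) + 1) := by
      obtain ⟨m, rfl⟩ := Nat.exists_eq_add_of_lt hn
      rw [Nat.add_sub_cancel]
      nlinarith
    exact ⟨by omega, fun h => by omega⟩
  · push Not at hcut
    obtain ⟨u, hu⟩ := hcut
    have hdeg := h.exists_ne_adj (by omega)
    obtain ⟨c₁, c₂, K₁, K₂, hT⟩ := SimpleGraph.exists_twoEnds hG hu (by omega)
    have ht : 1 ≤ (G.connectedBetween {c₁, c₂} (K₁ ∪ K₂)ᶜ).ncard := by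
      refine (ncard_pos (toFinite _)).2 ⟨_, ?_, Subset.rfl, hT.connected_middle hG⟩
      rintro x (rfl | rfl)
      exacts [hT.mem_middle₁, hT.mem_middle₂]
    have key := two_mul_bound_of_end_sizes (hT.cutsOff₁.two_le_ncard hdeg)
      (hT.cutsOff₂.two_le_ncard hdeg) ((ncard_pos (toFinite _)).2 ⟨c₁, hT.mem_middle₁⟩) ht
      (hT.ncard_middle.trans hV) (hT.le_ncard hG)
    refine ⟨key.1, fun heq => ?_⟩
    obtain ⟨h₁, h₂, h₃⟩ := key.2 heq
    exact hT.nonempty_iso hG hdeg h₁ h₂ h₃ hV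

theorem two_mul_numConnectedInduced_doubleTadpole {n : ℕ} (hn : 5 < n) :
    2 * numConnectedInduced (doubleTadpole n 3 3) = (n - 1) * (n + 6) :=
  (two_mul_numConnectedInduced_doubleTadpole_le hn).antisymm
    ((isConnectedWithPendants_doubleTadpole hn).le_two_mul_numConnectedInduced hn).1

theorem theorem3p10 (n : ℕ) (hn : 5 < n) :
    IsConnectedWithPendants (doubleTadpole n 3 3) n 0 ∧
    (numConnectedInduced (doubleTadpole n 3 3) : ℚ) = ((n : ℚ) - 1) * ((n : ℚ) + 6) / 2 ∧
    ∀ (V : Type*) [Fintype V] (G : SimpleGraph V), IsConnectedWithPendants G n 0 →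
      numConnectedInduced (doubleTadpole n 3 3) ≤ numConnectedInduced G ∧
      (numConnectedInduced G = numConnectedInduced (doubleTadpole n 3 3) ↔
        Nonempty (G ≃g doubleTadpole n 3 3)) := by
  have hD := two_mul_numConnectedInduced_doubleTadpole hn
  refine ⟨isConnectedWithPendants_doubleTadpole hn, ?_, fun V _ G hG => ?_⟩
  · rw [eq_div_iff two_ne_zero, mul_comm]
    have : ((2 * numConnectedInduced (doubleTadpole n 3 3) : ℕ) : ℚ) = ((n - 1) * (n + 6) : ℕ) :=
      congrArg _ hD
    push_cast [Nat.cast_sub (show 1 ≤ n by omega)] at this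
    exact this
  · obtain ⟨h1, h2⟩ := hG.le_two_mul_numConnectedInduced hn
    exact ⟨by omega, fun h => h2 (by omega), fun ⟨e⟩ => e.numConnectedInduced_eq⟩
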